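/- Let $\mathfrak c=2^{\aleph_0}$. For $f,g\in\omega^\omega$ write $f\le^* g$ if $f(n)\le g(n)$ for all but finitely many $n$, and let $\mathfrak d$ be the least cardinality of a set $X\subseteq\omega^\omega$ such that every $f\in\omega^\omega$ satisfies $f\le^* g$ for some $g\in X$. For a family $\mathscr F$ of finitary operations on $\omega^\omega$ (functions $F:(\omega^\omega)^n\to\omega^\omega$ with $n<\omega$) and an infinite cardinal $\kappa$, a $\langle\mathfrak d,\mathscr F,\kappa\rangle$-pathway is a sequence $\langle B_\alpha\mid\alpha<\kappa\rangle$ of subsets of $\omega^\omega$ which is increasing ($B_\alpha\subseteq B_\beta$ for $\alpha\le\beta<\kappa$) and continuous ($B_\alpha=\bigcup_{\xi<\alpha}B_\xi$ for limit $\alpha<\kappa$), and such that 1. $\bigcup_{\alpha<\kappa}B_\alpha=\omega^\omega$; 2. for every $\alpha<\kappa$ there is $f\in\omega^\omega$ with $f\not\le^* g$ for all $g\in B_\alpha$; 3. for every $\alpha<\kappa$ and every $F\in\mathscr F$ of arity $n$, $F[B_\alpha^n]\subseteq B_\alpha$. A P-point is a nonprincipal ultrafilter $u$ on $\omega$ such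 that for all $X_0,X_1,\dots\in u$ there is $Y\in u$ with $Y\setminus X_n$ finite for every $n$. A gruff ultrafilter is an ultrafilter $u$ on $\mathbb Q$ such that every $A\in u$ contains some $P\in u$ which is perfect, that is, closed in $\mathbb Q$ and without isolated points, for the usual topology of $\mathbb Q$. **Corollary.** Suppose $\mathfrak d=\mathfrak c$. Then for every finite family $\mathscr F$ of finitary operations on $\omega^\omega$ there is a $\langle\mathfrak d,\mathscr F,\mathfrak c\rangle$-pathway; there is also a $\langle\mathfrak d,\mathscr F,\operatorname{cf}(\mathfrak c)\rangle$-pathway, whose length is a regular cardinal. Moreover, there exist a P-point and a gruff ultrafilter. -/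

import Mathlib

/-- A cardinal characteristic of the continuum, presented by a triple `⟨A, B, E⟩` with
`|A|, |B| ≤ 𝔠`, `E ⊆ A × B`, and every `a : A` related to some `b : B`. -/
structure CardChar where
  A : Type
  B : Type
  E : A → B → Prop
  mk_A_le : Cardinal.mk A ≤ Cardinal.continuum
  mk_B_le : Cardinal.mk B ≤ Cardinal.continuum
  total : ∀ a, ∃ b, E a b

/-- The value of the characteristic: the least size of an `E`-dominating subset of `B`.
(The set of cardinals is nonempty, by `CardChar.total`, so the infimum is a minimum.) -/
noncomputable def CardChar.val (x : CardChar) : Cardinal.{0} :=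
  sInf {κ | ∃ X : Set x.B, Cardinal.mk X = κ ∧ ∀ a : x.A, ∃ b ∈ X, x.E a b}

/-- A finitary operation on `B`: an arity `n` and a function `Bⁿ → B`. -/
abbrev FinitaryOp (B : Type) : Type := Σ n : ℕ, ((Fin n → B) → B)

/-- `C` is closed under the finitary operation `F`. -/
def FinitaryOp.Closed {B : Type} (F : FinitaryOp B) (C : Set B) : Prop :=
  ∀ v : Fin F.1 → B, (∀ i, v i ∈ C) → F.2 v ∈ C

/-- `⟨Bs α | α < δ⟩` is an `⟨x, 𝓕⟩`-pathway of length the ordinal `δ`: a continuous increasing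
sequence of subsets of `B` with union `B`, none of them `E`-dominating, each closed under `𝓕`.
Only the values `Bs α` with `α < δ` matter. -/
structure IsPathway (x : CardChar) (𝓕 : Set (FinitaryOp x.B)) (δ : Ordinal.{0})
    (Bs : Ordinal.{0} → Set x.B) : Prop where
  increasing : ∀ α β, α ≤ β → β < δ → Bs α ⊆ Bs β
  continuous : ∀ α, α < δ → Order.IsSuccLimit α → Bs α = ⋃ ξ ∈ Set.Iio α, Bs ξ
  cover : ∀ y : x.B, ∃ α < δ, y ∈ Bs α
  not_dominating : ∀ α < δ, ∃ a : x.A, ∀ y ∈ Bs α, ¬ x.E a y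
  closed : ∀ α < δ, ∀ F ∈ 𝓕, F.Closed (Bs α)

/-- There is an `⟨x, 𝓕⟩`-pathway whose length is the (initial ordinal of the) cardinal `κ`. -/
def HasPathway (x : CardChar) (𝓕 : Set (FinitaryOp x.B)) (κ : Cardinal.{0}) : Prop :=
  ∃ Bs : Ordinal.{0} → Set x.B, IsPathway x 𝓕 κ.ord Bs

/-- The triple `⟨ω^ω, ω^ω, ≤*⟩`, where `f ≤* g` means `f n ≤ g n` for all but finitely many `n`. -/
def dominating : CardChar where
  A := ℕ → ℕ
  B := ℕ → ℕ
  E f g := ∀ᶠ n in Filter.atTop, f n ≤ g n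
  mk_A_le := by simp
  mk_B_le := by simp
  total f := ⟨f, Filter.Eventually.of_forall fun _ => le_rfl⟩

/-- A P-point: a nonprincipal ultrafilter on `ω` such that every countable subfamily has a
pseudointersection in the ultrafilter. -/
def IsPPoint (u : Ultrafilter ℕ) : Prop :=
  (∀ n : ℕ, {n} ∉ u) ∧
    ∀ X : ℕ → Set ℕ, (∀ n, X n ∈ u) → ∃ Y ∈ u, ∀ n, (Y \ X n).Finite

/-- A gruff ultrafilter: an ultrafilter on `ℚ` with a base of perfect (closed and crowded) subsets
of `ℚ`. -/
def IsGruff (u : Ultrafilter ℚ) : Prop :=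
  ∀ A ∈ u, ∃ P ∈ u, Perfect P ∧ P ⊆ A

open Cardinal Set Filter Topology

/-! Under 𝔡 = 𝔠, no family of fewer than 𝔠 functions is dominating; everything follows from this.
Pathways: rank `ω^ω` along a well-order of type 𝔠, or along a cofinal subset of it. Fewer than 𝔠
functions lie below any given rank, and finitely many operations generate from them still fewer than
𝔠, hence a non-dominating set. Ultrafilters: these come directly from a recursion on all
requirements (`exists_ultrafilter_of_step`). At each stage fewer than 𝔠 sets have been chosen, so
they have fewer than 𝔠 finite intersections. Each intersection asks that the new set be built with
large enough moves infinitely often, and `exists_frequently_le` gives one sequence of moves that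
serves them all. -/

theorem dominating_not_of_mk_lt (h : dominating.val = Cardinal.continuum) {X : Set (ℕ → ℕ)}
    (hX : #X < Cardinal.continuum) : ∃ a : ℕ → ℕ, ∀ b ∈ X, ¬ ∀ᶠ n in atTop, a n ≤ b n := by
  by_contra! hc
  have : dominating.val ≤ #X := csInf_le' ⟨X, rfl, hc⟩
  exact absurd hX (not_lt.2 (h ▸ this))

/-! ### Pathways from well-orders of `ω^ω`. -/

section Pathway

/-- The language whose function symbols are the members of a family of finitary operations. -/
def FinitaryOp.language {B : Type} (𝓕 : Set (FinitaryOp B)) : FirstOrder.Language.{0, 0} where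
  Functions n := {f : (Fin n → B) → B // (⟨n, f⟩ : FinitaryOp B) ∈ 𝓕}
  Relations _ := Empty

instance FinitaryOp.structure {B : Type} (𝓕 : Set (FinitaryOp B)) :
    (FinitaryOp.language 𝓕).Structure B where
  funMap f := f.1
  RelMap r := r.elim

/-- The least set containing `S` and closed under the operations in `𝓕`. -/
def FinitaryOp.hull {B : Type} (𝓕 : Set (FinitaryOp B)) (S : Set B) : Set B :=
  FirstOrder.Language.Substructure.closure (FinitaryOp.language 𝓕) S

namespace FinitaryOp

variable {B : Type} {𝓕 : Set (FinitaryOp B)} {S T : Set B}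

theorem subset_hull : S ⊆ hull 𝓕 S := FirstOrder.Language.Substructure.subset_closure

theorem hull_mono (h : S ⊆ T) : hull 𝓕 S ⊆ hull 𝓕 T :=
  FirstOrder.Language.Substructure.closure_mono h

theorem closed_hull {F : FinitaryOp B} (hF : F ∈ 𝓕) : F.Closed (hull 𝓕 S) := fun v hv =>
  (FirstOrder.Language.Substructure.closure (language 𝓕) S).fun_mem
    (⟨F.2, hF⟩ : (language 𝓕).Functions F.1) v hv

theorem hull_subset (h : S ⊆ T) (hT : ∀ F ∈ 𝓕, F.Closed T) : hull 𝓕 S ⊆ T := fun _ hx =>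
  FirstOrder.Language.Substructure.closure_induction (L := language 𝓕) (p := (· ∈ T)) hx h
    fun {n} f v hv => hT ⟨n, f.1⟩ f.2 v hv

theorem mk_hull_lt (h𝓕 : 𝓕.Finite) (hS : #S < continuum) : #(hull 𝓕 S) < continuum := by
  have hle := FirstOrder.Language.Substructure.lift_card_closure_le (L := language 𝓕) (s := S)
  have e : (Σ n, (language 𝓕).Functions n) ≃ 𝓕 :=
    { toFun := fun f => ⟨⟨f.1, f.2.1⟩, f.2.2⟩
      invFun := fun F => ⟨F.1.1, F.1.2, F.2⟩
      left_inv := fun _ => rfl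
      right_inv := fun _ => rfl }
  have hF : #(Σ n, (language 𝓕).Functions n) < ℵ₀ := by
    rw [e.cardinal_eq]; exact h𝓕.lt_aleph0
  simp only [Cardinal.lift_id] at hle
  exact hle.trans_lt (max_lt aleph0_lt_continuum
    (add_lt_of_lt aleph0_lt_continuum.le hS (hF.trans aleph0_lt_continuum)))

/-- An operation has finitely many arguments, so they all lie in the hull for one rank bound below
the limit `α`; hence the union of the earlier hulls is already closed. -/
theorem hull_lt_subset (ρ : B → Ordinal.{0}) {α : Ordinal.{0}} (hα : Order.IsSuccLimit α) :
    hull 𝓕 {y | ρ y < α} ⊆ ⋃ ξ ∈ Iio α, hull 𝓕 {y | ρ y < ξ} := by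
  refine hull_subset ?_ ?_
  · intro y hy
    refine mem_iUnion₂.2 ⟨Order.succ (ρ y), hα.succ_lt hy, subset_hull ?_⟩
    exact Order.lt_succ (ρ y)
  · intro F hF v hv
    have hv' : ∀ i, ∃ ξ < α, v i ∈ hull 𝓕 {y | ρ y < ξ} := fun i => by
      simpa only [mem_iUnion, exists_prop, mem_Iio] using hv i
    choose ξ hξ hvξ using hv'
    refine mem_iUnion₂.2 ⟨Finset.univ.sup ξ, (Finset.sup_lt_iff hα.bot_lt).2 fun i _ => hξ i, ?_⟩
    refine closed_hull hF v fun i => hull_mono (fun y hy => ?_) (hvξ i)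
    exact lt_of_lt_of_le hy (Finset.le_sup (f := ξ) (Finset.mem_univ i))

end FinitaryOp

open FinitaryOp in
/-- A rank function with small initial segments gives a pathway. -/
theorem isPathway_hull (h : dominating.val = Cardinal.continuum)
    {𝓕 : Set (FinitaryOp (ℕ → ℕ))} (h𝓕 : 𝓕.Finite) {δ : Ordinal.{0}} (hδ : Order.IsSuccLimit δ)
    (ρ : (ℕ → ℕ) → Ordinal.{0}) (hρ : ∀ y, ρ y < δ)
    (hsmall : ∀ α < δ, #{y | ρ y < α} < Cardinal.continuum) :
    IsPathway dominating 𝓕 δ fun α => hull 𝓕 {y | ρ y < α} where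
  increasing α β hαβ _ := hull_mono fun y hy => lt_of_lt_of_le hy hαβ
  continuous α _ hα := by
    refine Subset.antisymm (hull_lt_subset ρ hα) ?_
    · exact iUnion₂_subset fun ξ hξ => hull_mono fun y (hy : ρ y < ξ) =>
        show ρ y < α from hy.trans hξ
  cover y := ⟨Order.succ (ρ y), hδ.succ_lt (hρ y), subset_hull (Order.lt_succ (ρ y))⟩
  not_dominating α hα := dominating_not_of_mk_lt h (mk_hull_lt h𝓕 (hsmall α hα))
  closed _ _ _ hF := closed_hull hF

open Ordinal in
-- Rank `y` by the position in `s` of a point above `e y`. Functions ranked below `z₀` then embed in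
-- the initial segment of `W` below `z₀`, which has size less than 𝔠 because the type of `W` is an
-- initial ordinal.
theorem hasPathway_of_isCofinal (h : dominating.val = Cardinal.continuum)
    {𝓕 : Set (FinitaryOp (ℕ → ℕ))} (h𝓕 : 𝓕.Finite) {W : Type} [LinearOrder W] [WellFoundedLT W]
    (e : (ℕ → ℕ) ≃ W) (hW : ord #W = typeLT W) (s : Set W) (hs : IsCofinal s)
    {κ : Cardinal} (hκ : ℵ₀ ≤ κ) (hsκ : typeLT s = κ.ord) : HasPathway dominating 𝓕 κ := by
  have hWc : #W = continuum := by rw [← e.cardinal_eq]; simp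
  have hex : ∀ w : W, ∃ z : s, w ≤ z := fun w => by
    obtain ⟨z, hz, hwz⟩ := hs w
    exact ⟨⟨z, hz⟩, hwz⟩
  choose z hz using hex
  refine ⟨_, isPathway_hull h h𝓕 (isSuccLimit_ord hκ)
    (fun y => typein (α := s) (· < ·) (z (e y))) (fun y => hsκ ▸ typein_lt_type _ _) ?_⟩
  intro α hα
  rw [← hsκ] at hα
  obtain ⟨z₀, rfl⟩ := typein_surj (α := s) (· < ·) hα
  refine lt_of_le_of_lt ?_ (hWc ▸ mk_Iio_lt (z₀ : W) hW)
  refine mk_le_of_injective (f := fun y => ⟨e y.1, ?_⟩) ?_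
  · exact (hz _).trans_lt ((typein_lt_typein (α := s) (· < ·)).1 y.2)
  · intro x y hxy
    simpa [Subtype.ext_iff] using hxy

end Pathway

theorem hasPathway_continuum_and_cof (h : dominating.val = Cardinal.continuum)
    {𝓕 : Set (FinitaryOp (ℕ → ℕ))} (h𝓕 : 𝓕.Finite) :
    HasPathway dominating 𝓕 Cardinal.continuum ∧
      HasPathway dominating 𝓕 Cardinal.continuum.{0}.ord.cof := by
  let W : Type := continuum.{0}.ord.ToType
  have hWc : #W = continuum := mk_ord_toType _
  have hW : ord #W = Ordinal.type (α := W) (· < ·) := by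
    rw [hWc]; exact (Ordinal.type_toType _).symm
  obtain ⟨e⟩ : Nonempty ((ℕ → ℕ) ≃ W) := Cardinal.eq.1 (by rw [hWc]; simp)
  obtain ⟨s, hs, hsc⟩ := Ordinal.exists_ord_cof_eq W
  rw [← Ordinal.cof_type, ← hW, hWc] at hsc
  refine ⟨hasPathway_of_isCofinal h h𝓕 e hW univ (fun x => ⟨x, trivial, le_rfl⟩)
    aleph0_le_continuum ?_, hasPathway_of_isCofinal h h𝓕 e hW s hs ?_ hsc⟩
  · exact OrderIso.Set.univ.ordinalType_congr.trans (Ordinal.type_toType _)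
  · exact (isRegular_cof (isSuccLimit_ord aleph0_le_continuum)).aleph0_le

/-! ### Evasion of predictors, and ultrafilters by recursion. -/

/-- Fewer than `𝔡` predictors, each bounding the next move from the current state, are all evaded
infinitely often by a single sequence of moves. -/
theorem exists_frequently_le (h : dominating.val = Cardinal.continuum) {ι S : Type}
    (hι : #ι < Cardinal.continuum) [Countable S] (state : (ℕ → ℕ) → ℕ → S)
    (step : ℕ → S → ℕ → S) (hstate : ∀ g n, state g (n + 1) = step n (state g n) (g n))
    (p : ι → ℕ → S → ℕ) :
    ∃ g : ℕ → ℕ, ∀ i, ∃ᶠ n in atTop, p i n (state g n) ≤ g n := by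
  classical
  -- States reachable from `s` at time `N` in `k` moves, each at most the largest bound that
  -- predictor `i` gives on the states reachable so far. This set is finite, so `K` is a genuine
  -- function. If `g` stays below predictor `i` from `N` on, then `K (i, N, state g N)` dominates
  -- `g`; there are fewer than 𝔠 such functions.
  let R : ι → ℕ → S → ℕ → Finset S := fun i N s k => Nat.rec {s} (fun k R =>
    (R ×ˢ Finset.range (R.sup (p i (N + k)) + 1)).image fun x => step (N + k) x.1 x.2) k
  let K : ι × ℕ × S → ℕ → ℕ := fun x n => (R x.1 x.2.1 x.2.2 (n - x.2.1)).sup (p x.1 n)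
  have hX : #(range K) < continuum := by
    refine mk_range_le.trans_lt ?_
    rw [mk_prod]
    simp only [Cardinal.lift_id]
    exact mul_lt_of_lt aleph0_lt_continuum.le hι
      ((Cardinal.mk_le_aleph0 (α := ℕ × S)).trans_lt aleph0_lt_continuum)
  obtain ⟨g, hg⟩ := dominating_not_of_mk_lt h hX
  refine ⟨g, fun i hfin => ?_⟩
  obtain ⟨N, hN⟩ := eventually_atTop.1 hfin
  simp only [not_le] at hN
  refine hg _ ⟨(i, N, state g N), rfl⟩ (eventually_atTop.2 ⟨N, ?_⟩)
  have hR : ∀ k, state g (N + k) ∈ R i N (state g N) k := by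
    intro k
    induction k with
    | zero => exact Finset.mem_singleton_self _
    | succ k ih =>
      refine Finset.mem_image.2 ⟨(state g (N + k), g (N + k)), ?_, (hstate g (N + k)).symm⟩
      refine Finset.mem_product.2 ⟨ih, Finset.mem_range.2 (Nat.lt_succ_of_lt ?_)⟩
      exact (hN _ (Nat.le_add_right N k)).trans_le (Finset.le_sup (f := p i (N + k)) ih)
  intro n hn
  obtain ⟨k, rfl⟩ := Nat.exists_eq_add_of_le hn
  refine (hN _ hn).le.trans ?_
  simp only [K, Nat.add_sub_cancel_left]
  exact Finset.le_sup (f := p i (N + k)) (hR k)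

/-- Transfinite construction of an ultrafilter meeting continuum many conditional requirements. -/
theorem exists_ultrafilter_of_step {X T : Type} (hT : #T ≤ Cardinal.continuum) (I : Filter X)
    [I.NeBot] (D : T → Filter X) (R : T → Set X → Prop)
    (step : ∀ (𝓑 : Set (Set X)) (t : T), #𝓑 < Cardinal.continuum →
      (generate 𝓑 ⊓ D t ⊓ I).NeBot → ∃ P, R t P ∧ (generate (insert P 𝓑) ⊓ I).NeBot) :
    ∃ u : Ultrafilter X, ↑u ≤ I ∧ ∀ t, ↑u ≤ D t → ∃ P ∈ u, R t P := by
  classical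
  obtain ⟨_, _, hord⟩ := exists_ord_eq_type_lt T
  -- Whether `D t` will hold is not decided here. If finally `u ≤ D t`, then `u` itself witnesses
  -- the compatibility needed by `step`, so the first branch was taken at `t`.
  let next : T → Set (Set X) → Set X := fun t 𝓑 =>
    if ht : ∃ P, R t P ∧ (generate (insert P 𝓑) ⊓ I).NeBot then ht.choose else univ
  let P : T → Set X := WellFoundedLT.fix fun t P' => next t (range fun s : Iio t => P' s.1 s.2)
  have hP : ∀ t, P t = next t (P '' Iio t) := fun t => by
    have := WellFoundedLT.fix_eq (fun t P' => next t (range fun s : Iio t => P' s.1 s.2)) t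
    rw [image_eq_range]
    exact this
  have hunion : ∀ J : Set T, (∀ t ∈ J, (generate (P '' Iic t) ⊓ I).NeBot) →
      (generate (P '' J) ⊓ I).NeBot := by
    intro J hJ
    rw [inf_neBot_iff]
    intro A hA B hB
    obtain ⟨Q, hQ, hQf, hQA⟩ := mem_generate_iff.1 hA
    lift Q to Finset (Set X) using hQf
    obtain ⟨F, hFJ, rfl⟩ := Finset.subset_set_image_iff.1 hQ
    rcases F.eq_empty_or_nonempty with rfl | hF
    · refine (Filter.nonempty_of_mem hB).mono fun x hx => ⟨hQA (by simp), hx⟩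
    · have hmem : A ∈ generate (P '' Iic (F.max' hF)) := by
        refine mem_generate_iff.2 ⟨_, ?_, Finset.finite_toSet _, hQA⟩
        rw [Finset.coe_image]
        exact image_mono fun s hs => F.le_max' s hs
      exact inf_neBot_iff.1 (hJ _ (hFJ (F.max'_mem hF))) hmem hB
  have hIic : ∀ t, (generate (P '' Iic t) ⊓ I).NeBot := by
    intro t
    induction t using WellFoundedLT.induction with
    | ind t ih =>
      rw [← Iio_insert, image_insert_eq, hP t]
      by_cases ht : ∃ Q, R t Q ∧ (generate (insert Q (P '' Iio t)) ⊓ I).NeBot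
      · simp only [next, dif_pos ht]
        exact ht.choose_spec.2
      · simp only [next, dif_neg ht]
        refine (hunion (Iio t) ih).mono (inf_le_inf_right _ ?_)
        refine le_generate_iff.2 (insert_subset univ_mem fun A hA => ?_)
        exact mem_generate_iff.2 ⟨{A}, by simpa using hA, finite_singleton A, by simp⟩
  have := hunion univ fun t _ => hIic t
  have hle := Ultrafilter.of_le (generate (P '' univ) ⊓ I)
  have hmem : ∀ t, P t ∈ Ultrafilter.of (generate (P '' univ) ⊓ I) := fun t =>
    hle (mem_inf_of_left (GenerateSets.basic ⟨t, trivial, rfl⟩))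
  refine ⟨_, hle.trans inf_le_right, fun t ht => ⟨P t, hmem t, ?_⟩⟩
  have hlt : #(P '' Iio t) < continuum :=
    (mk_image_le.trans_lt (mk_Iio_lt t hord)).trans_le hT
  have hex := step (P '' Iio t) t hlt ((Ultrafilter.neBot _).mono (le_inf (le_inf
    (le_generate_iff.2 (image_subset_iff.2 fun s _ => hmem s)) ht) (hle.trans inf_le_right)))
  rw [hP t]
  simp only [next, dif_pos hex]
  exact hex.choose_spec.1

section FiniteIntersections

variable {X : Type} {𝓑 : Set (Set X)}

theorem mk_finset_lt_continuum {α : Type} (h : #α < Cardinal.continuum) :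
    #(Finset α) < Cardinal.continuum := by
  cases finite_or_infinite α
  · exact (lt_aleph0_of_finite _).trans aleph0_lt_continuum
  · rwa [mk_finset_of_infinite]

theorem biInter_mem_generate (F : Finset 𝓑) : ⋂ a ∈ F, (a : Set X) ∈ generate 𝓑 :=
  (biInter_finset_mem F).2 fun a _ => GenerateSets.basic a.2

theorem generate_insert_inf_neBot {P : Set X} {I : Filter X}
    (h : ∀ (F : Finset 𝓑), ∀ J ∈ I, (((⋂ a ∈ F, (a : Set X)) ∩ P) ∩ J).Nonempty) :
    (generate (insert P 𝓑) ⊓ I).NeBot := by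
  classical
  refine inf_neBot_iff.2 fun A hA J hJ => ?_
  obtain ⟨Q, hQ, hQf, hQA⟩ := mem_generate_iff.1 hA
  have hf : (Subtype.val ⁻¹' Q : Set 𝓑).Finite := hQf.preimage Subtype.val_injective.injOn
  refine (h hf.toFinset J hJ).mono (inter_subset_inter_left _ (Subset.trans ?_ hQA))
  rintro x ⟨hx, hxP⟩ q hq
  rcases hQ hq with rfl | hqB
  · exact hxP
  · exact mem_iInter₂.1 hx ⟨q, hqB⟩ (hf.mem_toFinset.2 hq)

end FiniteIntersections

/-! ### P-points. -/

theorem exists_isPPoint (h : dominating.val = Cardinal.continuum) :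
    ∃ u : Ultrafilter ℕ, IsPPoint u := by
  have step : ∀ (𝓑 : Set (Set ℕ)) (X : ℕ → Set ℕ), #𝓑 < Cardinal.continuum →
      (generate 𝓑 ⊓ (⨅ n, 𝓟 (X n)) ⊓ atTop).NeBot →
      ∃ Y : Set ℕ, (∀ n, (Y \ X n).Finite) ∧ (generate (insert Y 𝓑) ⊓ atTop).NeBot := by
    intro 𝓑 X h𝓑 hne
    have hk : ∀ (F : Finset 𝓑) (n : ℕ), ∃ k, n ≤ k ∧ k ∈ (⋂ a ∈ F, (a : Set ℕ)) ∧
        ∀ m ≤ n, k ∈ X m := by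
      intro F n
      have hX : {k | ∀ m ≤ n, k ∈ X m} ∈ ⨅ n, 𝓟 (X n) := by
        have := (biInter_mem (finite_Iic n)).2 fun m _ =>
          mem_iInf_of_mem (f := fun n => 𝓟 (X n)) m (mem_principal_self (X m))
        filter_upwards [this] with k hk m hm using mem_iInter₂.1 hk m hm
      obtain ⟨k, ⟨hk₁, hk₂⟩, hk₃⟩ := hne.nonempty_of_mem
        (inter_mem_inf (inter_mem_inf (biInter_mem_generate F) hX) (Ici_mem_atTop n))
      exact ⟨k, hk₃, hk₁, hk₂⟩
    choose k hnk hkF hkX using hk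
    -- Past moves do not matter here, so the state is trivial.
    obtain ⟨g, hg⟩ := exists_frequently_le h (mk_finset_lt_continuum h𝓑) (fun _ _ => ())
      (fun _ _ _ => ()) (fun _ _ => rfl) (fun F n _ => k F n)
    refine ⟨{k | ∃ n, n ≤ k ∧ k ≤ g n ∧ ∀ m ≤ n, k ∈ X m}, fun m => ?_, ?_⟩
    -- A point outside `X m` has a witness `n < m`, so it is bounded by one of `g 0, …, g (m - 1)`.
    · refine ((finite_Iio m).biUnion fun n _ => finite_Iic (g n)).subset ?_
      rintro k ⟨⟨n, -, hkg, hk⟩, hkm⟩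
      exact mem_biUnion (mem_Iio.2 (lt_of_not_ge fun hmn => hkm (hk m hmn))) hkg
    · refine generate_insert_inf_neBot fun F J hJ => ?_
      obtain ⟨N, hN⟩ := mem_atTop_sets.1 hJ
      obtain ⟨n, hn, hgn⟩ := (frequently_atTop.1 (hg F)) N
      exact ⟨k F n, ⟨hkF F n, n, hnk F n, hgn, hkX F n⟩, hN _ (hn.trans (hnk F n))⟩
  obtain ⟨u, hu, hR⟩ := exists_ultrafilter_of_step (X := ℕ) (T := ℕ → Set ℕ) (by simp) atTop
    (fun X => ⨅ n, 𝓟 (X n)) (fun X Y => ∀ n, (Y \ X n).Finite) step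
  refine ⟨u, fun n hn => ?_, fun X hX => hR X (le_iInf fun n => le_principal_iff.2 (hX n))⟩
  obtain ⟨m, hm, hm'⟩ := u.nonempty_of_mem (inter_mem hn (hu (Ioi_mem_atTop n)))
  exact absurd hm' (by simp [mem_singleton_iff.1 hm])

/-! ### Crowded sets and the coscattered filter. -/

section Crowded

variable {X : Type} [TopologicalSpace X]

theorem Preperfect.sUnion {𝓚 : Set (Set X)} (h : ∀ K ∈ 𝓚, Preperfect K) : Preperfect (⋃₀ 𝓚) := by
  rintro x ⟨K, hK, hx⟩
  exact (h K hK x hx).mono (principal_mono.2 (subset_sUnion_of_mem hK))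

/-- The largest subset without isolated points. -/
def crowdedKernel (A : Set X) : Set X := ⋃₀ {K | K ⊆ A ∧ Preperfect K}

theorem preperfect_crowdedKernel (A : Set X) : Preperfect (crowdedKernel A) :=
  Preperfect.sUnion fun _ hK => hK.2

theorem crowdedKernel_subset (A : Set X) : crowdedKernel A ⊆ A := sUnion_subset fun _ hK => hK.1

theorem Preperfect.subset_crowdedKernel {A K : Set X} (hK : Preperfect K) (h : K ⊆ A) :
    K ⊆ crowdedKernel A := subset_sUnion_of_mem ⟨h, hK⟩

theorem crowdedKernel_mono {A B : Set X} (h : A ⊆ B) : crowdedKernel A ⊆ crowdedKernel B :=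
  (preperfect_crowdedKernel A).subset_crowdedKernel ((crowdedKernel_subset A).trans h)

/-- Near a point `x` of `K`, deleting `x` from an open piece of `K` leaves a nonempty crowded set,
which must meet `A`. This makes `coscattered` closed under intersection. -/
theorem Preperfect.inter_of_forall_inter_nonempty [T1Space X] {K A : Set X} (hK : Preperfect K)
    (hA : ∀ L, Preperfect L → L.Nonempty → (L ∩ A).Nonempty) : Preperfect (K ∩ A) := by
  refine preperfect_iff_nhds.2 fun x hx U hU => ?_
  obtain ⟨V, hVU, hV, hxV⟩ := mem_nhds_iff.1 hU
  obtain ⟨y, ⟨hyV, hyK⟩, hyx⟩ := preperfect_iff_nhds.1 hK x hx.1 V (hV.mem_nhds hxV)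
  obtain ⟨z, ⟨⟨hzV, hzx⟩, hzK⟩, hzA⟩ := hA _ (hK.open_inter (hV.inter isOpen_compl_singleton))
    ⟨y, ⟨hyV, hyx⟩, hyK⟩
  exact ⟨z, ⟨hVU hzV, hzK, hzA⟩, hzx⟩

variable (X) in
/-- The filter of sets whose complement is scattered. -/
def coscattered [T1Space X] : Filter X where
  sets := {A | ∀ K, Preperfect K → K.Nonempty → (K ∩ A).Nonempty}
  univ_sets := fun K _ hne => by simpa using hne
  sets_of_superset := fun hA hAB K hK hne => (hA K hK hne).mono (inter_subset_inter_right K hAB)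
  inter_sets := fun {A B} hA hB K hK hne => by
    rw [← inter_assoc]
    exact hB _ (hK.inter_of_forall_inter_nonempty hA) (hA K hK hne)

theorem mem_coscattered [T1Space X] {A : Set X} :
    A ∈ coscattered X ↔ ∀ K, Preperfect K → K.Nonempty → (K ∩ A).Nonempty := Iff.rfl

end Crowded

/-! ### Gruff ultrafilters. -/

/-- The rationals lying outside finitely many closed balls. -/
def ballsCompl (T : Finset (ℚ × ℚ)) : Set ℚ := {x | ∀ b ∈ T, (b.2 : ℝ) < dist x b.1}

theorem isOpen_ballsCompl (T : Finset (ℚ × ℚ)) : IsOpen (ballsCompl T) := by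
  have : ballsCompl T = ⋂ b ∈ T, {x | (b.2 : ℝ) < dist x b.1} := by ext; simp [ballsCompl]
  rw [this]
  exact isOpen_biInter_finset fun b _ => isOpen_lt continuous_const (by fun_prop)

theorem ballsCompl_anti {T T' : Finset (ℚ × ℚ)} (h : T ⊆ T') : ballsCompl T' ⊆ ballsCompl T :=
  fun _ hx b hb => hx b (h hb)

theorem ballsCompl_mem_atTop (T : Finset (ℚ × ℚ)) : ballsCompl T ∈ (atTop : Filter ℚ) := by
  have : ∀ b ∈ T, ∀ᶠ x : ℚ in atTop, (b.2 : ℝ) < dist x b.1 := fun b _ => by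
    filter_upwards [Ioi_mem_atTop (b.1 + b.2)] with x hx
    have hx' : (b.1 + b.2 : ℝ) < x := by exact_mod_cast hx
    rw [Rat.dist_eq]
    exact (lt_sub_iff_add_lt'.2 hx').trans_le (le_abs_self _)
  exact (eventually_all_finset T).2 this

/-- Rational radii keep the states of the construction below countable. The radius 1 for `q ∈ S` is
a dummy value. -/
theorem exists_ball_separation (S : Finset ℚ) (q : ℚ) :
    ∃ δ : ℚ, 0 < δ ∧ (q ∉ S → ∀ s ∈ S, (δ : ℝ) < dist s q) := by
  by_cases hq : q ∈ S
  · exact ⟨1, one_pos, fun h => absurd hq h⟩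
  obtain ⟨ε, hε, hball⟩ := Metric.isOpen_iff.1 S.finite_toSet.isClosed.isOpen_compl q hq
  obtain ⟨δ, hδ, hδε⟩ := exists_rat_btwn hε
  refine ⟨δ, by exact_mod_cast hδ, fun _ s hs => hδε.trans_le (le_of_not_gt fun hlt => ?_)⟩
  exact hball hlt hs

/-- `P` is a union of finite sets, built while finitely many balls are forbidden. A move `m` admits
the allowed points of `K i₀` among the first `m` rationals; then, if `e n` has not been admitted, a
ball around it is forbidden, which makes `P` closed. Large enough moves, made infinitely often for
each `i`, add points of `K i` close to the earlier ones and points beyond `n`. Such points exist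
because `K i` is crowded and unbounded above, while finitely many balls are bounded. -/
theorem exists_perfect_subset (h : dominating.val = Cardinal.continuum) {ι : Type}
    (hι : #ι < Cardinal.continuum) (K : ι → Set ℚ) (hK : ∀ i, Preperfect (K i))
    (hKtop : ∀ i, ∀ J ∈ (atTop : Filter ℚ), (K i ∩ J).Nonempty) (i₀ : ι) (hi₀ : ∀ i, K i ⊆ K i₀) :
    ∃ P ⊆ K i₀, Perfect P ∧ ∀ i, Preperfect (P ∩ K i) ∧
      ∀ J ∈ (atTop : Filter ℚ), (P ∩ K i ∩ J).Nonempty := by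
  classical
  obtain ⟨e, he⟩ := exists_surjective_nat ℚ
  choose δ hδ₀ hδ using exists_ball_separation
  let grow : Finset ℚ × Finset (ℚ × ℚ) → ℕ → Finset ℚ := fun s m =>
    s.1 ∪ ((Finset.range m).image e).filter (· ∈ K i₀ ∩ ballsCompl s.2)
  let step : ℕ → Finset ℚ × Finset (ℚ × ℚ) → ℕ → Finset ℚ × Finset (ℚ × ℚ) := fun n s m =>
    (grow s m, if e n ∈ grow s m then s.2 else insert (e n, δ (grow s m) (e n)) s.2)
  let state : (ℕ → ℕ) → ℕ → Finset ℚ × Finset (ℚ × ℚ) := fun g n =>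
    Nat.rec (∅, ∅) (fun n s => step n s (g n)) n
  have hmove : ∀ (i : ι) (n : ℕ) (s : Finset ℚ × Finset (ℚ × ℚ)), ∃ m : ℕ,
      (∀ x ∈ s.1, x ∈ K i → x ∈ ballsCompl s.2 → ∃ j < m, e j ∈ K i ∩ ballsCompl s.2 ∧
        dist (e j) x < 1 / ((n : ℝ) + 1) ∧ e j ≠ x) ∧
      ∃ j < m, e j ∈ K i ∩ ballsCompl s.2 ∧ (n : ℚ) < e j := by
    intro i n s
    have h₁ : ∀ x : ℚ, ∃ j, x ∈ K i → x ∈ ballsCompl s.2 → e j ∈ K i ∩ ballsCompl s.2 ∧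
        dist (e j) x < 1 / ((n : ℝ) + 1) ∧ e j ≠ x := by
      intro x
      by_cases hx : x ∈ K i ∧ x ∈ ballsCompl s.2
      · obtain ⟨y, ⟨⟨hyb, hyT⟩, hyK⟩, hyx⟩ := preperfect_iff_nhds.1 (hK i) x hx.1 _
          (inter_mem (Metric.ball_mem_nhds x (Nat.one_div_pos_of_nat (α := ℝ) (n := n)))
            ((isOpen_ballsCompl s.2).mem_nhds hx.2))
        obtain ⟨j, rfl⟩ := he y
        exact ⟨j, fun _ _ => ⟨⟨hyK, hyT⟩, hyb, hyx⟩⟩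
      · exact ⟨0, fun h₁ h₂ => absurd ⟨h₁, h₂⟩ hx⟩
    choose j hj using h₁
    obtain ⟨y, hyK, hyT, hyn⟩ := hKtop i _ (inter_mem (ballsCompl_mem_atTop s.2)
      (Ioi_mem_atTop (n : ℚ)))
    obtain ⟨j', rfl⟩ := he y
    refine ⟨max (s.1.sup j) j' + 1, fun x hx hxK hxT => ⟨j x, ?_, hj x hxK hxT⟩,
      j', by omega, ⟨hyK, hyT⟩, hyn⟩
    have := Finset.le_sup (f := j) hx
    omega
  choose p hpK hptop using hmove
  obtain ⟨g, hg⟩ := exists_frequently_le h hι state step (fun _ _ => rfl) p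
  have hsucc : ∀ n, state g (n + 1) = step n (state g n) (g n) := fun _ => rfl
  have hinv : ∀ n, ∀ x ∈ (state g n).1, x ∈ K i₀ ∧ x ∈ ballsCompl (state g n).2 := by
    intro n
    induction n with
    | zero => exact fun x hx => absurd hx (Finset.notMem_empty x)
    | succ n ih =>
      intro x hx
      have hx' : x ∈ K i₀ ∧ x ∈ ballsCompl (state g n).2 := by
        rcases Finset.mem_union.1 hx with hx | hx
        · exact ih x hx
        · exact (Finset.mem_filter.1 hx).2
      refine ⟨hx'.1, ?_⟩
      rw [hsucc] at hx ⊢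
      simp only [step] at hx ⊢
      split_ifs with hn
      · exact hx'.2
      · intro b hb
        rcases Finset.mem_insert.1 hb with rfl | hb
        · exact hδ _ _ hn x hx
        · exact hx'.2 b hb
  have hmono : Monotone fun n => (state g n).1 :=
    monotone_nat_of_le_succ fun n => Finset.subset_union_left
  have hmono' : Monotone fun n => (state g n).2 := monotone_nat_of_le_succ fun n => by
    simp only [hsucc, step]
    split_ifs
    exacts [le_rfl, Finset.subset_insert _ _]
  have hmem : ∀ n j, j < g n → e j ∈ K i₀ → e j ∈ ballsCompl (state g n).2 →
      e j ∈ (state g (n + 1)).1 := fun n j hj hjK hjT =>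
    Finset.mem_union_right _ (Finset.mem_filter.2
      ⟨Finset.mem_image_of_mem e (Finset.mem_range.2 hj), hjK, hjT⟩)
  let P : Set ℚ := {x | ∃ n, x ∈ (state g n).1}
  have hPT : ∀ n, P ⊆ ballsCompl (state g n).2 := by
    rintro n x ⟨m, hm⟩
    exact ballsCompl_anti (hmono' (le_max_left n m)) (hinv _ x (hmono (le_max_right n m) hm)).2
  have hPK : P ⊆ K i₀ := fun x ⟨n, hn⟩ => (hinv n x hn).1
  have hacc : ∀ i, Preperfect (P ∩ K i) := by
    refine fun i => preperfect_iff_nhds.2 ?_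
    rintro x ⟨⟨N, hxN⟩, hxK⟩ U hU
    obtain ⟨ε, hε, hball⟩ := Metric.mem_nhds_iff.1 hU
    obtain ⟨M, hM⟩ := exists_nat_one_div_lt hε
    obtain ⟨n, hn, hgn⟩ := frequently_atTop.1 (hg i) (max N M)
    obtain ⟨j, hj, ⟨hjK, hjT⟩, hjx, hne⟩ := hpK i n (state g n) x
      (hmono ((le_max_left _ _).trans hn) hxN) hxK (hPT n ⟨N, hxN⟩)
    refine ⟨e j, ⟨hball ?_, ⟨n + 1, hmem n j (hj.trans_le hgn) (hi₀ i hjK) hjT⟩, hjK⟩, hne⟩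
    exact hjx.trans ((Nat.one_div_le_one_div ((le_max_right _ _).trans hn)).trans_lt hM)
  refine ⟨P, hPK, ⟨?_, ?_⟩, fun i => ⟨hacc i, fun J hJ => ?_⟩⟩
  · refine isOpen_compl_iff.1 (Metric.isOpen_iff.2 fun x hx => ?_)
    obtain ⟨n, rfl⟩ := he x
    have hn : e n ∉ grow (state g n) (g n) := fun hn => hx ⟨n + 1, hn⟩
    refine ⟨δ (grow (state g n) (g n)) (e n), by exact_mod_cast hδ₀ _ _, fun y hy hyP => ?_⟩
    refine lt_asymm hy (hPT (n + 1) hyP (e n, _) ?_)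
    simp only [hsucc, step, if_neg hn]
    exact Finset.mem_insert_self _ _
  · have := hacc i₀
    rwa [inter_eq_left.2 hPK] at this
  · obtain ⟨r, hr⟩ := mem_atTop_sets.1 hJ
    obtain ⟨N, hN⟩ := exists_nat_ge r
    obtain ⟨n, hn, hgn⟩ := frequently_atTop.1 (hg i) N
    obtain ⟨j, hj, ⟨hjK, hjT⟩, hjn⟩ := hptop i n (state g n)
    refine ⟨e j, ⟨⟨n + 1, hmem n j (hj.trans_le hgn) (hi₀ i hjK) hjT⟩, hjK⟩, hr _ ?_⟩
    exact hN.trans ((Nat.cast_le.2 hn).trans hjn.le)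

theorem exists_isGruff (h : dominating.val = Cardinal.continuum) :
    ∃ u : Ultrafilter ℚ, IsGruff u := by
  -- Together with `hpos`: a filter is compatible with `atTop ⊓ coscattered ℚ` exactly when each
  -- member contains a crowded set unbounded above. If the kernel of `A` misses a ray, then `A` is
  -- scattered on that ray, so the complement of this part is coscattered.
  have hker : ∀ {F : Filter ℚ} {A : Set ℚ}, (F ⊓ (atTop ⊓ coscattered ℚ)).NeBot → A ∈ F →
      ∀ J ∈ (atTop : Filter ℚ), (crowdedKernel A ∩ J).Nonempty := by
    intro F A hne hA J hJ
    obtain ⟨r, hr⟩ := mem_atTop_sets.1 hJ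
    by_contra hemp
    have hsc : (A ∩ Ioi r)ᶜ ∈ coscattered ℚ := by
      refine mem_coscattered.2 fun K hK ⟨x, hx⟩ => ?_
      by_contra hK'
      have hKA : K ⊆ A ∩ Ioi r := fun y hy => by
        by_contra hy'
        exact hK' ⟨y, hy, hy'⟩
      exact hemp ⟨x, hK.subset_crowdedKernel (hKA.trans inter_subset_left) hx,
        hr x (le_of_lt (hKA hx).2)⟩
    obtain ⟨x, hxA, hxr, hx⟩ := hne.nonempty_of_mem
      (inter_mem_inf hA (inter_mem_inf (Ioi_mem_atTop r) hsc))
    exact hx ⟨hxA, hxr⟩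
  have hpos : ∀ {F : Filter ℚ}, (∀ A ∈ F, ∃ K ⊆ A, Preperfect K ∧
      ∀ J ∈ (atTop : Filter ℚ), (K ∩ J).Nonempty) → (F ⊓ (atTop ⊓ coscattered ℚ)).NeBot := by
    intro F hF
    refine inf_neBot_iff.2 fun A hA J hJ => ?_
    obtain ⟨J₁, hJ₁, J₂, hJ₂, rfl⟩ := mem_inf_iff.1 hJ
    obtain ⟨K, hKA, hK, hKtop⟩ := hF A hA
    obtain ⟨r, hr⟩ := mem_atTop_sets.1 hJ₁
    obtain ⟨x, ⟨hxr, hxK⟩, hx⟩ := hJ₂ _ (hK.open_inter (isOpen_Ioi (a := r)))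
      (by simpa only [inter_comm] using hKtop _ (Ioi_mem_atTop r))
    exact ⟨x, hKA hxK, hr x (le_of_lt hxr), hx⟩
  have : (atTop ⊓ coscattered ℚ : Filter ℚ).NeBot := by
    have := hpos (F := ⊤) fun A hA => ⟨univ, by rw [mem_top.1 hA],
      isOpen_univ.preperfect, fun J hJ => by simpa using Filter.nonempty_of_mem hJ⟩
    rwa [top_inf_eq] at this
  have step : ∀ (𝓑 : Set (Set ℚ)) (A : Set ℚ), #𝓑 < Cardinal.continuum →
      (generate 𝓑 ⊓ 𝓟 A ⊓ (atTop ⊓ coscattered ℚ)).NeBot → ∃ P : Set ℚ, (Perfect P ∧ P ⊆ A) ∧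
        (generate (insert P 𝓑) ⊓ (atTop ⊓ coscattered ℚ)).NeBot := by
    intro 𝓑 A h𝓑 hne
    -- The index `∅` gives the largest of these kernels, that of `A` itself.
    let K : Finset 𝓑 → Set ℚ := fun F => crowdedKernel ((⋂ a ∈ F, (a : Set ℚ)) ∩ A)
    obtain ⟨P, hPA, hP, hPK⟩ := exists_perfect_subset h (mk_finset_lt_continuum h𝓑) K
      (fun F => preperfect_crowdedKernel _)
      (fun F => hker hne (inter_mem_inf (biInter_mem_generate F) (mem_principal_self A))) ∅
      (fun F => crowdedKernel_mono (inter_subset_inter_left _ (by simp)))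
    refine ⟨P, ⟨hP, hPA.trans ((crowdedKernel_subset _).trans inter_subset_right)⟩, ?_⟩
    refine generate_insert_inf_neBot fun F J hJ => ?_
    have hne' : (𝓟 (P ∩ K F) ⊓ (atTop ⊓ coscattered ℚ)).NeBot :=
      hpos fun B hB => ⟨_, mem_principal.1 hB, hPK F⟩
    obtain ⟨x, ⟨hxP, hxK⟩, hxJ⟩ := hne'.nonempty_of_mem (inter_mem_inf (mem_principal_self _) hJ)
    exact ⟨x, ⟨((crowdedKernel_subset _) hxK).1, hxP⟩, hxJ⟩
  obtain ⟨u, -, hR⟩ := exists_ultrafilter_of_step (X := ℚ) (T := Set ℚ) (by simp)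
    (atTop ⊓ coscattered ℚ) 𝓟 (fun A P => Perfect P ∧ P ⊆ A) step
  exact ⟨u, fun A hA => hR A (le_principal_iff.2 hA)⟩

theorem corollary4p3 (h : dominating.val = Cardinal.continuum) :
    (∀ 𝓕 : Set (FinitaryOp (ℕ → ℕ)), 𝓕.Finite →
      HasPathway dominating 𝓕 Cardinal.continuum ∧
      (Cardinal.continuum.{0}.ord.cof.IsRegular ∧
        HasPathway dominating 𝓕 Cardinal.continuum.{0}.ord.cof)) ∧
    (∃ u : Ultrafilter ℕ, IsPPoint u) ∧
    (∃ u : Ultrafilter ℚ, IsGruff u) :=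
  ⟨fun _ h𝓕 => ⟨(hasPathway_continuum_and_cof h h𝓕).1,
    isRegular_cof (isSuccLimit_ord aleph0_le_continuum), (hasPathway_continuum_and_cof h h𝓕).2⟩,
    exists_isPPoint h, exists_isGruff h⟩
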